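/- Throughout, a point configuration is a finite set $\mathcal P\subset\mathbb R^n$; a face of a configuration $C$ is the nonempty set of points of $C$ at which some linear functional attains its maximum over $C$. A subdivision of $\mathcal P$ is a collection $\Sigma$ of nonempty subsets of $\mathcal P$ (cells) such that every face of a cell is a cell, $\bigcup_{C\in\Sigma}\operatorname{conv} C=\operatorname{conv}\mathcal P$, and $\operatorname{relint}\operatorname{conv} C\cap\operatorname{relint}\operatorname{conv} C'=\emptyset$ for distinct cells $C,C'$. It is trivial if $\mathcal P$ is a cell. It refines $\Sigma'$ if each of its cells is contained in a cell of $\Sigma'$. It is coarsest if it is nontrivial and the only subdivisions that it refines are itself and the trivial one. A $k$-split of $\mathcal P$ is a coarsest subdivision $\Sigma$ of $\mathcal P$ with exactly $k$ inclusion-maximal cells that have a common face $H\in\Sigma$ with $\dim H=\dim\operatorname{conv}\mathcal P-(k-1)$ and $\operatorname{relint}\operatorname{conv} H\subseteq\operatorname{relint}\operatorname{conv}\mathcal P$. **Lemma.** Let $j\ge 1$, let $\Delta_{j-1}=\{x\in\mathbb R^j : x_i\ge 0,\ \sum_i x_i=1\}$, and let $\mathcal P_j\subset\mathbb R^{j}\times\mathbb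 R^{j}=\mathbb R^{2j}$ be the point configuration consisting of the vertices of $\Delta_{j-1}\times\Delta_{j-1}$ together with its barycenter $q=\sum_{i=1}^{2j}\frac1j e_i$. Then $\mathcal P_j$ has no $(2j-1)$-split. -/

import Mathlib

namespace PointConfig

variable {E : Type*} [AddCommGroup E] [Module ℝ E] [TopologicalSpace E]

/-- `F` is a (nonempty) face of the point configuration `C`: the set of points of `C` at which
some linear functional attains its maximum over `C`. The zero functional shows that a nonempty
configuration is a face of itself. -/
def IsFace (F C : Set E) : Prop :=
  F.Nonempty ∧ ∃ l : E →ₗ[ℝ] ℝ, F = {x ∈ C | ∀ y ∈ C, l y ≤ l x}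

/-- Relative interior of the convex hull of a configuration. -/
def relint (C : Set E) : Set E := intrinsicInterior ℝ (convexHull ℝ C)

/-- Dimension of (the convex hull of) a configuration. -/
noncomputable def dim (C : Set E) : ℕ := Module.finrank ℝ (vectorSpan ℝ C)

/-- `S` is a polyhedral subdivision of the finite point configuration `P`: a collection of nonempty
subsets of `P` with the Closure, Union and Intersection Properties. -/
structure IsSubdivision (P : Set E) (S : Set (Set E)) : Prop where
  subset : ∀ C ∈ S, C ⊆ P
  nonempty : ∀ C ∈ S, C.Nonempty
  closure : ∀ C ∈ S, ∀ F, IsFace F C → F ∈ S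
  union : (⋃ C ∈ S, convexHull ℝ C) = convexHull ℝ P
  inter : ∀ C ∈ S, ∀ C' ∈ S, C ≠ C' → Disjoint (relint C) (relint C')

/-- `S` refines `T` (equivalently, `T` is coarser than `S`). -/
def Refines (S T : Set (Set E)) : Prop := ∀ C ∈ S, ∃ D ∈ T, C ⊆ D

/-- `S` is a coarsest subdivision of `P`: it is nontrivial (`P` itself is not a cell), and every
subdivision that it refines is `S` or the trivial one, i.e. the one having `P` as a cell. -/
def IsCoarsest (P : Set E) (S : Set (Set E)) : Prop :=
  IsSubdivision P S ∧ P ∉ S ∧ ∀ T, IsSubdivision P T → Refines S T → T = S ∨ P ∈ T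

/-- The inclusion-maximal cells. -/
def maximalCells (S : Set (Set E)) : Set (Set E) := {C | Maximal (· ∈ S) C}

/-- `S` is a `k`-split of `P`: a coarsest subdivision with exactly `k` maximal cells and a common
face `H` of all of them, of codimension `k - 1` and interior to `P`. -/
def IsKSplit (k : ℕ) (P : Set E) (S : Set (Set E)) : Prop :=
  IsCoarsest P S ∧ (maximalCells S).encard = k ∧
    ∃ H ∈ S, (∀ C ∈ maximalCells S, IsFace H C) ∧ dim H + k = dim P + 1 ∧ relint H ⊆ relint P

/-- The product of two `(j - 1)`-simplices in `ℝ^j × ℝ^j`. -/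
def prodSimplices (j : ℕ) : Set ((Fin j → ℝ) × (Fin j → ℝ)) :=
  stdSimplex ℝ (Fin j) ×ˢ stdSimplex ℝ (Fin j)

/-- The vertices of the product of two `(j - 1)`-simplices, together with its barycenter, the
point all of whose `2 j` coordinates are `1 / j`. -/
noncomputable def prodSimplicesConfig (j : ℕ) : Set ((Fin j → ℝ) × (Fin j → ℝ)) :=
  insert (fun _ => 1 / (j : ℝ), fun _ => 1 / (j : ℝ)) ((prodSimplices j).extremePoints ℝ)

end PointConfig

/-! For `j = 1` the configuration is one point and has only the trivial subdivision. Let `j ≥ 2` and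
`d = 2j - 2`, which bounds the dimension of the configuration. The codimension condition forces
dimension exactly `d` and makes `H` a single point; being relatively interior, it is the barycenter
`q`, because every other point is extreme in the product.

So `d + 1` maximal cells have `q` as a vertex, and their cones at `q` are closed, pointed and cover
the `d`-dimensional direction space. By `exists_common_ray` any `d` of these cones share a ray.
Cells of a subdivision meeting at a point other than `q` share a configuration point other than `q`,
so for each maximal cell there is a vertex `v` lying in all the others. The functionals exposing `q`
in the cells then show that a nontrivial relation among the `d + 1` vectors `v - q` has all
coefficients nonzero and of one sign (`coeff_pos_of_relation`).

Vertices of the product are edges of the bipartite graph on `j + j` nodes, and a relation is a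
weighting of the edges with equal weight at every node. With `2j - 1` edges some node on the left
has degree at most one; positive weights make its edge an isolated component. Deleting that edge
leaves enough dependence for a nontrivial relation vanishing on it, a contradiction
(`not_all_relations_pos`). -/

namespace PointConfig

/-! ### Finitely generated cones -/

section Hull

variable {E : Type*} [AddCommGroup E] [Module ℝ E]

/-- The cone generated by some vectors of an open half-space is pointed. -/
theorem hull_pointed {G : Set E} (l : E →ₗ[ℝ] ℝ) (hl : ∀ g ∈ G, l g < 0) :
    ∀ x ∈ PointedCone.hull ℝ G, x ≠ 0 → l x < 0 := by
  intro x hx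
  induction hx using Submodule.span_induction with
  | mem x hx => exact fun _ => hl x hx
  | zero => exact fun h => absurd rfl h
  | add x y _ _ hx hy =>
    intro h
    rw [map_add]
    by_cases hx0 : x = 0
    · subst hx0
      simpa using hy (by simpa using h)
    · have h1 := hx hx0
      by_cases hy0 : y = 0
      · simpa [hy0] using h1
      · exact add_neg h1 (hy hy0)
  | smul a x _ hx =>
    intro h
    have ha : a ≠ 0 := by rintro rfl; simp at h
    have hx0 : x ≠ 0 := by rintro rfl; simp at h
    have hpos : 0 < (a : ℝ) := lt_of_le_of_ne a.2 fun h' => ha (Subtype.ext h'.symm)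
    have : l (a • x) = (a : ℝ) * l x := l.map_smul (a : ℝ) x
    rw [this]
    exact mul_neg_of_pos_of_neg hpos (hx hx0)

theorem mem_hull_finset_iff (G : Finset E) (x : E) :
    x ∈ PointedCone.hull ℝ (G : Set E) ↔
      ∃ a : E → ℝ, (∀ g, 0 ≤ a g) ∧ ∑ g ∈ G, a g • g = x := by
  constructor
  · intro hx
    obtain ⟨a, -, ha⟩ := Submodule.mem_span_finset.1 hx
    exact ⟨fun g => (a g : ℝ), fun g => (a g).2, ha⟩
  · rintro ⟨a, ha, rfl⟩
    exact Submodule.sum_mem _ fun g hg =>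
      Submodule.smul_mem _ (⟨a g, ha g⟩ : {c : ℝ // 0 ≤ c}) (Submodule.subset_span hg)

end Hull

/-! ### Closed pointed cones: separation, covering, closedness -/

section Cones

variable {E : Type*} [NormedAddCommGroup E] [NormedSpace ℝ E] [FiniteDimensional ℝ E]

/-- A slice of a closed pointed cone is compact. -/
theorem isCompact_cone_slice {K : Set E} (hK : IsClosed K)
    (hsmul : ∀ t : ℝ, 0 ≤ t → ∀ x ∈ K, t • x ∈ K) (l : E →L[ℝ] ℝ)
    (hl : ∀ x ∈ K, x ≠ 0 → l x < 0) : IsCompact {x ∈ K | l x = -1} := by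
  have hS : IsCompact (K ∩ Metric.sphere (0 : E) 1) :=
    (isCompact_sphere (0 : E) 1).inter_left hK
  have hcl : IsClosed {x ∈ K | l x = -1} :=
    hK.inter (isClosed_eq l.continuous continuous_const)
  rcases (K ∩ Metric.sphere (0 : E) 1).eq_empty_or_nonempty with he | hne
  · have : {x ∈ K | l x = -1} = ∅ := by
      rw [Set.eq_empty_iff_forall_notMem]
      rintro x ⟨hx, hx1⟩
      have hx0 : x ≠ 0 := by rintro rfl; simp at hx1
      have : ‖x‖⁻¹ • x ∈ K ∩ Metric.sphere (0 : E) 1 := by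
        refine ⟨hsmul _ (by positivity) x hx, ?_⟩
        simp [norm_smul, hx0]
      rw [he] at this
      exact this
    rw [this]; exact isCompact_empty
  · obtain ⟨z, hz, hmax⟩ := hS.exists_isMaxOn hne l.continuous.continuousOn
    have hz0 : z ≠ 0 := by
      rintro rfl
      simpa using hz.2
    have hlz := hl z hz.1 hz0
    -- By homogeneity `l x ≤ ‖x‖ * l z` on the cone, so `l x = -1` bounds the norm by `(-(l z))⁻¹`.
    refine (isCompact_closedBall (0 : E) (-(l z))⁻¹).of_isClosed_subset hcl ?_
    rintro x ⟨hx, hx1⟩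
    have hx0 : x ≠ 0 := by rintro rfl; simp at hx1
    have hpos : 0 < ‖x‖ := norm_pos_iff.2 hx0
    have h1 : ‖x‖⁻¹ • x ∈ K ∩ Metric.sphere (0 : E) 1 := by
      refine ⟨hsmul _ (by positivity) x hx, ?_⟩
      simp [norm_smul, hx0]
    have h2 : l (‖x‖⁻¹ • x) ≤ l z := hmax h1
    rw [map_smul, smul_eq_mul, hx1] at h2
    rw [mem_closedBall_zero_iff]
    have h3 : -(l z) ≤ ‖x‖⁻¹ := by linarith
    rw [le_inv_comm₀ hpos (by linarith)]
    exact h3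

/-- Two closed pointed cones meeting only in the origin are strictly separated. -/
theorem exists_separating_of_pointed {K L : PointedCone ℝ E} (hK : IsClosed (K : Set E))
    (hL : IsClosed (L : Set E)) (lK lL : E →ₗ[ℝ] ℝ) (hlK : ∀ x ∈ K, x ≠ 0 → lK x < 0)
    (hlL : ∀ x ∈ L, x ≠ 0 → lL x < 0) (hKL : ∀ x ∈ K, x ∈ L → x = 0) :
    ∃ f : E →ₗ[ℝ] ℝ, (∀ x ∈ K, x ≠ 0 → f x < 0) ∧ ∀ x ∈ L, x ≠ 0 → 0 < f x := by
  have sm : ∀ (M : PointedCone ℝ E) (t : ℝ), 0 ≤ t → ∀ x ∈ M, t • x ∈ M :=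
    fun M t ht x hx => M.smul_mem ht hx
  -- Slicing the product cone, rather than each cone, gives a compact convex set of nonzero pairs;
  -- its differences avoid the origin, and separating them from it separates the two cones.
  let l : E × E →L[ℝ] ℝ := (LinearMap.toContinuousLinearMap lK).coprod
    (LinearMap.toContinuousLinearMap lL)
  have hlapp : ∀ z : E × E, l z = lK z.1 + lL z.2 := fun z => rfl
  have hle : ∀ z ∈ (K : Set E) ×ˢ (L : Set E), z ≠ 0 → l z < 0 := by
    rintro ⟨x, y⟩ ⟨hx, hy⟩ hz
    rw [hlapp]
    by_cases hx0 : x = 0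
    · have hy0 : y ≠ 0 := by rintro rfl; exact hz (by rw [hx0]; rfl)
      simpa [hx0] using hlL y hy hy0
    · have h1 := hlK x hx hx0
      by_cases hy0 : y = 0
      · simpa [hy0] using h1
      · exact add_neg h1 (hlL y hy hy0)
  have hcomp := isCompact_cone_slice (hK.prod hL)
    (fun t ht z hz => ⟨sm K t ht _ hz.1, sm L t ht _ hz.2⟩) l hle
  have hconv : Convex ℝ {z ∈ (K : Set E) ×ˢ (L : Set E) | l z = -1} :=
    (K.convex.prod L.convex).inter (convex_hyperplane l.toLinearMap.isLinear _)
  let sub : E × E →L[ℝ] E := ContinuousLinearMap.fst ℝ E E - ContinuousLinearMap.snd ℝ E E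
  have hB := hcomp.image sub.continuous
  have hBc := hconv.linear_image sub.toLinearMap
  have h0 : (0 : E) ∉ sub '' {z ∈ (K : Set E) ×ˢ (L : Set E) | l z = -1} := by
    rintro ⟨⟨x, y⟩, ⟨⟨hx, hy⟩, hz⟩, hxy⟩
    have hxy' : x = y := sub_eq_zero.1 hxy
    subst hxy'
    have := hKL x hx hy
    subst this
    rw [hlapp] at hz
    simp at hz
  obtain ⟨f, u, hf, hu⟩ := geometric_hahn_banach_closed_point hBc hB.isClosed h0
  rw [map_zero] at hu
  have key : ∀ z ∈ (K : Set E) ×ˢ (L : Set E), z ≠ 0 → f (z.1 - z.2) < 0 := by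
    intro z hz hz0
    have hlz := hle z hz hz0
    have hpos : 0 < (-(l z))⁻¹ := inv_pos.2 (by linarith)
    have hmem : (-(l z))⁻¹ • z ∈ {z ∈ (K : Set E) ×ˢ (L : Set E) | l z = -1} := by
      refine ⟨⟨sm K _ hpos.le _ hz.1, sm L _ hpos.le _ hz.2⟩, ?_⟩
      rw [map_smul, smul_eq_mul, inv_mul_eq_div, div_eq_iff (by linarith)]; ring
    have h1 := hf _ ⟨_, hmem, rfl⟩
    have h2 : sub ((-(l z))⁻¹ • z) = (-(l z))⁻¹ • (z.1 - z.2) := by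
      rw [map_smul]; rfl
    change f (sub _) < u at h1
    rw [h2, map_smul, smul_eq_mul] at h1
    exact neg_of_mul_neg_right (h1.trans hu) hpos.le
  refine ⟨f.toLinearMap, fun x hx hx0 => ?_, fun x hx hx0 => ?_⟩
  · simpa using key (x, 0) ⟨hx, L.zero_mem⟩ (by simpa using hx0)
  · simpa using key (0, x) ⟨K.zero_mem, hx⟩ (by simpa using hx0)

/-- If a `d`-dimensional space is covered by `d + 1` closed pointed cones, then any `d` of the
cones share a ray. -/
theorem exists_common_ray {ι : Type*} (K : ι → PointedCone ℝ E) (l : ι → E →ₗ[ℝ] ℝ)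
    (hK : ∀ i, IsClosed (K i : Set E)) (hl : ∀ i, ∀ x ∈ K i, x ≠ 0 → l i x < 0) (i₀ : ι)
    (s : Finset ι) (hs : s.Nonempty) : ∀ V : Submodule ℝ E, Module.finrank ℝ V = s.card →
    (∀ x ∈ V, x ∈ K i₀ ∨ ∃ i ∈ s, x ∈ K i) → ∃ u ∈ V, u ≠ 0 ∧ ∀ i ∈ s, u ∈ K i := by
  induction hs using Finset.Nonempty.cons_induction with
  | singleton k =>
    intro V hV hcov
    have : Nontrivial V := Module.nontrivial_of_finrank_pos (R := ℝ) (by rw [hV]; simp)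
    obtain ⟨w, hwV, hw⟩ := V.exists_mem_ne_zero_of_ne_bot
      ((Submodule.nontrivial_iff_ne_bot).1 this)
    simp only [Finset.mem_singleton, exists_eq_left, forall_eq] at hcov ⊢
    rcases hcov w hwV with h1 | h1
    · rcases hcov (-w) (V.neg_mem hwV) with h2 | h2
      · have a := hl _ _ h1 hw
        have b := hl _ _ h2 (neg_ne_zero.2 hw)
        rw [map_neg] at b
        linarith
      · exact ⟨-w, V.neg_mem hwV, neg_ne_zero.2 hw, h2⟩
    · exact ⟨w, hwV, hw, h1⟩
  | cons k s hks hs ih =>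
    intro V hV hcov
    by_contra! hno
    let V' : PointedCone ℝ E := V.restrictScalars _
    have hV' : IsClosed (V' : Set E) := V.closed_of_finiteDimensional
    let L : PointedCone ℝ E := (⨅ i ∈ s, K i) ⊓ V'
    have hmemL : ∀ x, x ∈ L ↔ (∀ i ∈ s, x ∈ K i) ∧ x ∈ V := by
      intro x
      simp [L, V', Submodule.mem_inf, Submodule.mem_iInf]
    have hLcl : IsClosed (L : Set E) := by
      have : (L : Set E) = (⋂ i ∈ s, (K i : Set E)) ∩ V' := by
        ext x; simp [L]
      rw [this]
      exact (isClosed_biInter fun i _ => hK i).inter hV'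
    obtain ⟨i₁, hi₁⟩ := hs
    have hne : ∃ y ∈ V, y ≠ 0 := by
      have : Nontrivial V := Module.nontrivial_of_finrank_pos (R := ℝ) (by rw [hV]; simp)
      exact V.exists_mem_ne_zero_of_ne_bot ((Submodule.nontrivial_iff_ne_bot).1 this)
    -- The kernel of `f` must cut `V` in a hyperplane. If the separating functional vanishes on `V`,
    -- both cones are trivial there and any functional nonzero on `V` serves.
    obtain ⟨f, hf1, hf2, hf3⟩ : ∃ f : E →ₗ[ℝ] ℝ, (∀ x ∈ V, x ∈ K k → x ≠ 0 → f x ≠ 0) ∧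
        (∀ x ∈ L, x ≠ 0 → f x ≠ 0) ∧ ∃ y ∈ V, f y ≠ 0 := by
      obtain ⟨f, hf1, hf2⟩ := exists_separating_of_pointed (K := K k ⊓ V') (L := L)
        ((hK k).inter hV') hLcl (l k) (l i₁) (fun x hx => hl k x hx.1)
        (fun x hx => hl i₁ x (((hmemL x).1 hx).1 i₁ hi₁)) (by
          intro x hx hxL
          by_contra hx0
          obtain ⟨i, hi, hn⟩ := hno x hx.2 hx0
          rcases Finset.mem_cons.1 hi with rfl | hi
          · exact hn hx.1
          · exact hn (((hmemL x).1 hxL).1 i hi))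
      by_cases hfV : ∃ y ∈ V, f y ≠ 0
      · exact ⟨f, fun x hx hxk h0 => (hf1 x ⟨hxk, hx⟩ h0).ne, fun x hx h0 => (hf2 x hx h0).ne',
          hfV⟩
      · push Not at hfV
        obtain ⟨y, hy, hy0⟩ := hne
        obtain ⟨g, hg⟩ : ∃ g : Module.Dual ℝ E, g y ≠ 0 := by
          by_contra! h
          exact hy0 ((Module.forall_dual_apply_eq_zero_iff ℝ y).1 h)
        refine ⟨g, fun x hx hxk h0 => absurd (hfV x hx) (hf1 x ⟨hxk, hx⟩ h0).ne,
          fun x hx h0 => absurd (hfV x ((hmemL x).1 hx).2) (hf2 x hx h0).ne', y, hy, hg⟩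
    have hrank : Module.finrank ℝ (V ⊓ LinearMap.ker f : Submodule ℝ E) = s.card := by
      have h1 : f.domRestrict V ≠ 0 := by
        obtain ⟨y, hy, hfy⟩ := hf3
        intro h
        exact hfy (by simpa using LinearMap.congr_fun h ⟨y, hy⟩)
      have h2 := Module.Dual.finrank_ker_add_one_of_ne_zero h1
      have h3 : (LinearMap.ker (f.domRestrict V)).map V.subtype = V ⊓ LinearMap.ker f := by
        ext x; simp [Submodule.mem_map, and_comm]
      rw [← h3, Submodule.finrank_map_subtype_eq]
      rw [hV, Finset.card_cons] at h2
      omega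
    -- The cone of `k` meets the hyperplane only in the origin, so the remaining cones still cover
    -- it; their common ray there lies in `L`, where `f` cannot vanish.
    obtain ⟨u, hu, hu0, hus⟩ := ih (V ⊓ LinearMap.ker f) hrank (by
      rintro x ⟨hxV, hxf⟩
      by_cases hx0 : x = 0
      · left; rw [hx0]; exact (K i₀).zero_mem
      rcases hcov x hxV with h | ⟨i, hi, h⟩
      · exact Or.inl h
      · rcases Finset.mem_cons.1 hi with rfl | hi
        · exact absurd hxf (hf1 x hxV h hx0)
        · exact Or.inr ⟨i, hi, h⟩)
    exact hf2 u ((hmemL u).2 ⟨hus, hu.1⟩) hu0 hu.2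

/-- The cone generated by finitely many vectors of an open half-space is closed. -/
theorem isClosed_hull (G : Finset E) (l : E →ₗ[ℝ] ℝ) (hl : ∀ g ∈ G, l g < 0) :
    IsClosed (PointedCone.hull ℝ (G : Set E) : Set E) := by
  rw [← closure_subset_iff_isClosed]
  intro x hx
  obtain ⟨δ, hδ, hδG⟩ : ∃ δ : ℝ, 0 < δ ∧ ∀ g ∈ G, l g ≤ -δ := by
    rcases G.eq_empty_or_nonempty with rfl | hG
    · exact ⟨1, one_pos, by simp⟩
    · obtain ⟨g, hg, hmax⟩ := G.exists_max_image (fun g => l g) hG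
      exact ⟨-l g, by linarith [hl g hg], fun g' hg' => by simpa using hmax g' hg'⟩
  have hcont : Continuous l := l.continuous_of_finiteDimensional
  -- Where `l y > l x - 1`, every coefficient of `y` is at most `R`, since each generator
  -- contributes at most `-δ`. Near `x` the cone is thus inside a compact image of a box.
  let R : ℝ := (1 - l x) / δ
  have hbox : IsCompact (Set.pi Set.univ fun _ : E => Set.Icc (0 : ℝ) R) :=
    isCompact_univ_pi fun _ => isCompact_Icc
  have him := hbox.image (f := fun a : E → ℝ => ∑ g ∈ G, a g • g)
    (by fun_prop)
  have hopen : IsOpen {y : E | l x - 1 < l y} := isOpen_lt continuous_const hcont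
  have h1 : x ∈ closure ({y : E | l x - 1 < l y} ∩ (PointedCone.hull ℝ (G : Set E) : Set E)) :=
    hopen.inter_closure ⟨by simp, hx⟩
  have h2 : {y : E | l x - 1 < l y} ∩ (PointedCone.hull ℝ (G : Set E) : Set E) ⊆
      (fun a : E → ℝ => ∑ g ∈ G, a g • g) '' (Set.pi Set.univ fun _ : E => Set.Icc (0 : ℝ) R) := by
    classical
    rintro y ⟨hy, hyG⟩
    obtain ⟨a, ha, rfl⟩ := (mem_hull_finset_iff G y).1 hyG
    refine ⟨fun g => if g ∈ G then a g else 0, fun g _ => ?_,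
      Finset.sum_congr rfl fun g hg => by simp [hg]⟩
    have hsum : ∑ g ∈ G, a g * δ ≤ 1 - l x := by
      have : l (∑ g ∈ G, a g • g) ≤ - ∑ g ∈ G, a g * δ := by
        rw [map_sum, ← Finset.sum_neg_distrib]
        refine Finset.sum_le_sum fun g hg => ?_
        rw [map_smul, smul_eq_mul]
        nlinarith [ha g, hδG g hg]
      have hy' : l x - 1 < l (∑ g ∈ G, a g • g) := hy
      linarith
    have hnn : ∀ g ∈ G, 0 ≤ a g * δ := fun g _ => mul_nonneg (ha g) hδ.le
    by_cases hg : g ∈ G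
    · simp only [hg, if_true]
      refine ⟨ha g, ?_⟩
      rw [le_div_iff₀ hδ]
      exact (Finset.single_le_sum hnn hg).trans hsum
    · simp only [hg, if_false]
      refine ⟨le_rfl, div_nonneg ((Finset.sum_nonneg hnn).trans hsum) hδ.le⟩
  have h3 := closure_minimal h2 him.isClosed h1
  obtain ⟨a, ha, rfl⟩ := h3
  exact (mem_hull_finset_iff G _).2 ⟨a, fun g => (ha g trivial).1, rfl⟩

end Cones

/-! ### Relative interiors, supporting functionals and local cones -/

section RelInterior

variable {E : Type*} [NormedAddCommGroup E] [NormedSpace ℝ E]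

/-- From a relative interior point one can move a little in every direction of the span. -/
theorem exists_add_smul_mem_of_mem_intrinsicInterior {s : Set E} {x u : E}
    (hx : x ∈ intrinsicInterior ℝ s) (hu : u ∈ vectorSpan ℝ s) :
    ∃ ε : ℝ, 0 < ε ∧ x + ε • u ∈ s := by
  obtain ⟨y, hy, rfl⟩ := hx
  have hmem : ∀ t : ℝ, (y : E) + t • u ∈ affineSpan ℝ s := fun t => by
    rw [add_comm]
    exact AffineSubspace.vadd_mem_of_mem_direction
      (by rw [direction_affineSpan]; exact Submodule.smul_mem _ _ hu) y.2
  let φ : ℝ → affineSpan ℝ s := fun t => ⟨(y : E) + t • u, hmem t⟩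
  have hφ : Continuous φ := by
    refine Continuous.subtype_mk ?_ _
    fun_prop
  have h0 : φ 0 = y := Subtype.ext (by simp [φ])
  have hnhds : φ ⁻¹' interior ((↑) ⁻¹' s) ∈ nhds (0 : ℝ) :=
    hφ.continuousAt.preimage_mem_nhds (by rw [h0]; exact isOpen_interior.mem_nhds hy)
  obtain ⟨δ, hδ, hball⟩ := Metric.mem_nhds_iff.1 hnhds
  refine ⟨δ / 2, by linarith, ?_⟩
  have : δ / 2 ∈ Metric.ball (0 : ℝ) δ := by
    rw [mem_ball_zero_iff, Real.norm_eq_abs, abs_of_pos (by linarith)]; linarith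
  have h := interior_subset (s := ((↑) ⁻¹' s : Set (affineSpan ℝ s))) (hball this)
  exact h

/-- A point of a convex set off the relative interior has a supporting functional that is not
constant on the set. -/
theorem exists_support_of_notMem_intrinsicInterior [FiniteDimensional ℝ E] {s : Set E}
    (hs : Convex ℝ s) {x : E} (hxs : x ∈ s) (hx : x ∉ intrinsicInterior ℝ s) :
    ∃ l : E →ₗ[ℝ] ℝ, (∀ y ∈ s, l y ≤ l x) ∧ ∃ y ∈ s, l y < l x := by
  -- Moving `x` to the origin of the direction space turns the relative interior into an ordinary
  -- interior, where Hahn-Banach applies.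
  let V := vectorSpan ℝ s
  have hxa : x ∈ affineSpan ℝ s := subset_affineSpan ℝ s hxs
  let D : Set V := {w | x + (w : E) ∈ s}
  have hDc : Convex ℝ D := by
    intro a ha b hb α β hα hβ hαβ
    have := hs ha hb hα hβ hαβ
    change x + ((α • a + β • b : V) : E) ∈ s
    convert this using 1
    have hx1 : x = (α + β) • x := by rw [hαβ, one_smul]
    push_cast
    nth_rewrite 1 [hx1]
    module
  have hmem : ∀ w : V, x + (w : E) ∈ affineSpan ℝ s := fun w => by
    rw [add_comm]
    exact AffineSubspace.vadd_mem_of_mem_direction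
      (by rw [direction_affineSpan]; exact w.2) hxa
  have hdir : ∀ p : affineSpan ℝ s, (p : E) - x ∈ V := fun p => by
    have := AffineSubspace.vsub_mem_direction p.2 hxa
    rwa [direction_affineSpan] at this
  let φ : affineSpan ℝ s → V := fun p => ⟨(p : E) - x, hdir p⟩
  have hφ : Continuous φ := by
    refine Continuous.subtype_mk ?_ _
    fun_prop
  let ψ : V → affineSpan ℝ s := fun w => ⟨x + (w : E), hmem w⟩
  have hψ : Continuous ψ := by
    refine Continuous.subtype_mk ?_ _
    fun_prop
  have h0 : (0 : V) ∉ interior D := by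
    intro h
    refine hx ⟨⟨x, hxa⟩, ?_, rfl⟩
    rw [mem_interior]
    refine ⟨φ ⁻¹' interior D, fun p hp => ?_, isOpen_interior.preimage hφ, ?_⟩
    · have : φ p ∈ D := interior_subset hp
      change x + ((p : E) - x) ∈ s at this
      simpa using this
    · change φ ⟨x, hxa⟩ ∈ interior D
      convert h
      exact Subtype.ext (sub_self x)
  have hne : (interior D).Nonempty := by
    obtain ⟨-, p, hp, rfl⟩ := Set.Nonempty.intrinsicInterior hs ⟨x, hxs⟩
    refine ⟨φ p, mem_interior.2 ⟨ψ ⁻¹' interior ((↑) ⁻¹' s : Set (affineSpan ℝ s)), fun w hw => ?_,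
      isOpen_interior.preimage hψ, ?_⟩⟩
    · exact interior_subset (s := ((↑) ⁻¹' s : Set (affineSpan ℝ s))) hw
    · change ψ (φ p) ∈ interior ((↑) ⁻¹' s : Set (affineSpan ℝ s))
      convert hp
      exact Subtype.ext (by simp [ψ, φ])
  obtain ⟨f, hf⟩ := geometric_hahn_banach_open_point hDc.interior isOpen_interior h0
  rw [map_zero] at hf
  have hfD : ∀ w ∈ D, f w ≤ 0 := by
    intro w hw
    have hcl : w ∈ closure (interior D) := by
      rw [hDc.closure_interior_eq_closure_of_nonempty_interior hne]
      exact subset_closure hw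
    exact closure_minimal (fun a ha => (hf a ha).le)
      (isClosed_le f.continuous continuous_const) hcl
  obtain ⟨l, hl⟩ := LinearMap.exists_extend f.toLinearMap
  have hlV : ∀ w : V, l w = f w := fun w => LinearMap.congr_fun hl w
  refine ⟨l, fun y hy => ?_, ?_⟩
  · let w : V := φ ⟨y, subset_affineSpan ℝ s hy⟩
    have hw : w ∈ D := by
      change x + (y - x) ∈ s
      simpa using hy
    have h1 := hfD w hw
    rw [← hlV] at h1
    change l (y - x) ≤ 0 at h1
    rw [map_sub] at h1
    linarith
  · obtain ⟨a, ha⟩ := hne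
    refine ⟨x + a, interior_subset (s := D) ha, ?_⟩
    rw [map_add, hlV]
    linarith [hf a ha]

/-- A point of a convex hull at which a functional is maximal lies in the hull of the maximizing
generators. -/
theorem mem_convexHull_face {F : Set E} {x : E} (hx : x ∈ convexHull ℝ F) (l : E →ₗ[ℝ] ℝ)
    (hl : ∀ y ∈ F, l y ≤ l x) : x ∈ convexHull ℝ {y ∈ F | l y = l x} := by
  classical
  rw [convexHull_eq] at hx
  obtain ⟨ι, t, w, z, hw, hw1, hz, hxz⟩ := hx
  -- A weighted sum of nonnegative gaps vanishes, so every point of positive weight is a maximizer.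
  have hsum : ∑ i ∈ t, w i * (l x - l (z i)) = 0 := by
    have h1 : l x = ∑ i ∈ t, w i * l (z i) := by
      rw [← hxz, Finset.centerMass_eq_of_sum_1 _ _ hw1, map_sum]
      simp
    simp only [mul_sub, Finset.sum_sub_distrib, ← Finset.sum_mul, hw1, one_mul]
    rw [← h1, sub_self]
  have hzero := (Finset.sum_eq_zero_iff_of_nonneg fun i hi =>
    mul_nonneg (hw i hi) (sub_nonneg.2 (hl _ (hz i hi)))).1 hsum
  have hmem : (t.filter fun i => w i ≠ 0).centerMass w z ∈ convexHull ℝ {y ∈ F | l y = l x} := by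
    refine Finset.centerMass_mem_convexHull _ (fun i hi => hw i (Finset.mem_filter.1 hi).1) ?_ ?_
    · rw [Finset.sum_filter_ne_zero, hw1]
      exact one_pos
    · intro i hi
      obtain ⟨hi, hi0⟩ := Finset.mem_filter.1 hi
      refine ⟨hz i hi, ?_⟩
      rcases mul_eq_zero.1 (hzero i hi) with h | h
      · exact absurd h hi0
      · linarith
  rwa [Finset.centerMass_filter_ne_zero, hxz] at hmem

/-- Directions in the cone of a cell at one of its points lead into the cell. -/
theorem exists_forall_add_smul_mem {C : Set E} {q : E} (hq : q ∈ C) (G : Finset E)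
    (hG : ∀ g ∈ G, q + g ∈ C) {u : E} (hu : u ∈ PointedCone.hull ℝ (G : Set E)) :
    ∃ δ : ℝ, 0 < δ ∧ ∀ ε, 0 < ε → ε ≤ δ → q + ε • u ∈ convexHull ℝ C := by
  obtain ⟨a, ha, rfl⟩ := (mem_hull_finset_iff G u).1 hu
  have hA : 0 ≤ ∑ g ∈ G, a g := Finset.sum_nonneg fun g _ => ha g
  -- This bound keeps the weight `1 - ε * ∑ a g` left for `q` nonnegative.
  refine ⟨(1 + ∑ g ∈ G, a g)⁻¹, by positivity, fun ε hε hεδ => ?_⟩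
  have h1 : ε * ∑ g ∈ G, a g ≤ 1 := by
    calc ε * ∑ g ∈ G, a g ≤ (1 + ∑ g ∈ G, a g)⁻¹ * (1 + ∑ g ∈ G, a g) := by
          apply mul_le_mul hεδ (by linarith) hA (by positivity)
      _ = 1 := inv_mul_cancel₀ (by positivity)
  have hq' := subset_convexHull ℝ C hq
  have key : q + ε • ∑ g ∈ G, a g • g =
      (1 - ε * ∑ g ∈ G, a g) • q + ∑ g ∈ G, (ε * a g) • (q + g) := by
    simp only [smul_add, Finset.sum_add_distrib, ← Finset.sum_smul, ← Finset.mul_sum,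
      Finset.smul_sum, smul_smul]
    module
  rw [key]
  have := (convex_convexHull ℝ C).sum_mem (t := Finset.insertNone G)
    (w := fun o : Option E => o.elim (1 - ε * ∑ g ∈ G, a g) fun g => ε * a g)
    (z := fun o : Option E => o.elim q fun g => q + g) ?_ ?_ ?_
  · simpa [Finset.sum_insertNone] using this
  · intro o _
    cases o with
    | none => simpa using h1
    | some g => exact mul_nonneg hε.le (ha g)
  · simp [Finset.sum_insertNone, ← Finset.mul_sum]
  · intro o ho
    cases o with
    | none => exact hq'
    | some g => exact subset_convexHull ℝ C (hG g (by simpa using ho))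

/-- A direction leading into a cell lies in the cone of the cell. -/
theorem mem_hull_of_add_smul_mem {C : Set E} {q : E} (G : Finset E)
    (hG : ∀ v ∈ C, v ≠ q → v - q ∈ G) {u : E} {ε : ℝ} (hε : 0 < ε)
    (hu : q + ε • u ∈ convexHull ℝ C) : u ∈ PointedCone.hull ℝ (G : Set E) := by
  have hconv : Convex ℝ {x : E | x - q ∈ PointedCone.hull ℝ (G : Set E)} := by
    have := (PointedCone.hull ℝ (G : Set E)).convex.translate_preimage_right (-q)
    simpa [Set.preimage, neg_add_eq_sub] using this
  have hsub : convexHull ℝ C ⊆ {x : E | x - q ∈ PointedCone.hull ℝ (G : Set E)} := by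
    refine convexHull_min (fun v hv => ?_) hconv
    by_cases hvq : v = q
    · simp [hvq]
    · exact Submodule.subset_span (hG v hv hvq)
  have h1 : ε • u ∈ PointedCone.hull ℝ (G : Set E) := by simpa using hsub hu
  have h2 := (PointedCone.hull ℝ (G : Set E)).smul_mem (inv_nonneg.2 hε.le) h1
  rwa [smul_smul, inv_mul_cancel₀ hε.ne', one_smul] at h2

end RelInterior

/-! ### Carrier cells of points -/

section Carrier

variable {E : Type*} [NormedAddCommGroup E] [NormedSpace ℝ E] [FiniteDimensional ℝ E]

/-- Every point of a cell lies in the relative interior of some cell contained in it. -/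
theorem IsSubdivision.exists_carrier {P : Set E} {S : Set (Set E)} (hP : P.Finite)
    (hS : IsSubdivision P S) {C : Set E} (hC : C ∈ S) {x : E} (hx : x ∈ convexHull ℝ C) :
    ∃ F ∈ S, F ⊆ C ∧ x ∈ relint F := by
  have hfin : {F | F ∈ S ∧ x ∈ convexHull ℝ F}.Finite :=
    hP.finite_subsets.subset fun F hF => hS.subset F hF.1
  -- In a minimal cell whose hull contains `x`, a supporting functional at `x` would cut out a
  -- smaller such cell.
  obtain ⟨F, hFC, hF⟩ := hfin.exists_le_minimal (a := C) ⟨hC, hx⟩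
  refine ⟨F, hF.prop.1, hFC, ?_⟩
  by_contra hxF
  obtain ⟨l, hl, y, hy, hly⟩ :=
    exists_support_of_notMem_intrinsicInterior (convex_convexHull ℝ F) hF.prop.2 hxF
  have hlF : ∀ y ∈ F, l y ≤ l x := fun y hy => hl y (subset_convexHull ℝ F hy)
  have hx' := mem_convexHull_face hF.prop.2 l hlF
  have hne : {y ∈ F | l y = l x}.Nonempty := convexHull_nonempty_iff.1 ⟨x, hx'⟩
  have hface : IsFace {y ∈ F | l y = l x} F := by
    refine ⟨hne, l, ?_⟩
    obtain ⟨z, hz, hzx⟩ := hne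
    ext y
    refine ⟨fun h => ⟨h.1, fun w hw => h.2 ▸ hlF w hw⟩, fun h => ⟨h.1, ?_⟩⟩
    exact le_antisymm (hlF y h.1) (hzx ▸ h.2 z hz)
  have hmin := hF.le_of_le ⟨hS.closure F hF.prop.1 _ hface, hx'⟩ (fun y hy => hy.1)
  have hconst : convexHull ℝ F ⊆ {y | l y = l x} :=
    convexHull_min (fun y hy => (hmin hy).2) (convex_hyperplane l.isLinear _)
  exact hly.ne (hconst hy)

/-- If finitely many cells share a ray emanating from `q`, they share a point other than `q`. -/
theorem IsSubdivision.exists_common_point {P : Set E} {S : Set (Set E)} (hP : P.Finite)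
    (hS : IsSubdivision P S) {M : Set (Set E)} (hMS : M ⊆ S) (hM : M.Nonempty) {x q : E}
    (hx : ∀ C ∈ M, x ∈ convexHull ℝ C) (hxq : x ≠ q) : ∃ v ≠ q, ∀ C ∈ M, v ∈ C := by
  obtain ⟨C₀, hC₀⟩ := hM
  obtain ⟨F, hF, hFC, hxF⟩ := hS.exists_carrier hP (hMS hC₀) (hx C₀ hC₀)
  -- Carriers of the same point have intersecting relative interiors, hence coincide.
  have hall : ∀ C ∈ M, F ⊆ C := by
    intro C hC
    obtain ⟨F', hF', hFC', hxF'⟩ := hS.exists_carrier hP (hMS hC) (hx C hC)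
    by_cases h : F = F'
    · exact h ▸ hFC'
    · exact absurd hxF' (Set.disjoint_left.1 (hS.inter F hF F' hF' h) hxF)
  obtain ⟨v, hv, hvq⟩ : ∃ v ∈ F, v ≠ q := by
    by_contra! h
    have : x ∈ convexHull ℝ {q} := convexHull_mono (fun y hy => h y hy)
      (intrinsicInterior_subset hxF)
    rw [convexHull_singleton] at this
    exact hxq this
  exact ⟨v, hvq, fun C hC => hall C hC hv⟩

end Carrier

/-! ### Signs of linear relations -/

section Relations

variable {E ι : Type*} [AddCommGroup E] [Module ℝ E] [Fintype ι]

/-- Let every vector `u m` lie in all the open half-spaces `l k < 0` with `k ≠ m`, and let these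
half-spaces cover all nonzero vectors. Then the coefficients of a nontrivial linear relation among
the `u m` are nonzero and have the same sign. -/
theorem coeff_pos_of_relation (V : Submodule ℝ E) (u : ι → E) (l : ι → E →ₗ[ℝ] ℝ)
    (hu : ∀ i, u i ∈ V) (hl : ∀ k m, k ≠ m → l k (u m) < 0)
    (hcov : ∀ x ∈ V, x ≠ 0 → ∃ k, l k x < 0) (c : ι → ℝ) (hc : ∑ i, c i • u i = 0) {i : ι}
    (hi : 0 < c i) (k : ι) : 0 < c k := by
  have hneg : ∀ (d : ι → ℝ) (k m : ι), (∀ i, 0 ≤ d i) → d k = 0 → 0 < d m →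
      l k (∑ i, d i • u i) < 0 := by
    intro d k m hd hk hm
    rw [map_sum]
    simp only [map_smul, smul_eq_mul]
    refine Finset.sum_neg' (fun i _ => ?_) ⟨m, Finset.mem_univ _, ?_⟩
    · by_cases hki : k = i
      · rw [← hki, hk, zero_mul]
      · exact mul_nonpos_of_nonneg_of_nonpos (hd i) (hl k i hki).le
    · exact mul_neg_of_pos_of_neg hm (hl k m (by rintro rfl; exact hm.ne' hk))
  -- Positive and negative parts of the relation give the same vector. Each `l k` is negative on a
  -- nontrivial nonnegative combination omitting `u k`, and one of the two parts always omits it.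
  have hxy : ∑ i, max (c i) 0 • u i = ∑ i, max (-c i) 0 • u i := by
    rw [← sub_eq_zero, ← Finset.sum_sub_distrib, ← hc]
    refine Finset.sum_congr rfl fun i _ => ?_
    rw [← sub_smul]
    congr 1
    rcases le_total (c i) 0 with h | h
    · rw [max_eq_right h, max_eq_left (by linarith)]; ring
    · rw [max_eq_left h, max_eq_right (by linarith)]; ring
  have hpos : ∀ k, c k ≤ 0 → l k (∑ i, max (c i) 0 • u i) < 0 := fun k hk =>
    hneg _ k i (fun _ => le_max_right _ _) (max_eq_right hk) (lt_max_of_lt_left hi)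
  by_contra! hk
  by_cases hex : ∃ m, c m < 0
  · obtain ⟨m, hm⟩ := hex
    -- All functionals are negative at this vector, so its negative is nonzero and lies in no
    -- half-space.
    have hall : ∀ k, l k (∑ i, max (c i) 0 • u i) < 0 := by
      intro k
      rcases le_total (c k) 0 with h | h
      · exact hpos k h
      · rw [hxy]
        exact hneg _ k m (fun _ => le_max_right _ _) (max_eq_right (by linarith))
          (lt_max_of_lt_left (by linarith))
    have hmem : -(∑ i, max (c i) 0 • u i) ∈ V :=
      V.neg_mem (V.sum_mem fun i _ => V.smul_mem _ (hu i))
    obtain ⟨k', hk'⟩ := hcov _ hmem (by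
      intro h
      have := hall k
      rw [neg_eq_zero.1 h, map_zero] at this
      exact this.false)
    rw [map_neg] at hk'
    linarith [hall k']
  · push Not at hex
    have hzero : ∑ i, max (c i) 0 • u i = 0 := by
      rw [hxy]
      exact Finset.sum_eq_zero fun i _ => by
        rw [max_eq_right (by linarith [hex i]), zero_smul]
    have := hpos k hk
    rw [hzero, map_zero] at this
    exact this.false

end Relations

/-! ### Vertices as edges of a bipartite graph -/

section Bipartite

/-- The pairs of vectors with vanishing coordinate sums. -/
def sumZero (j : ℕ) : Submodule ℝ ((Fin j → ℝ) × (Fin j → ℝ)) :=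
  LinearMap.ker ((∑ i, LinearMap.proj (R := ℝ) (φ := fun _ : Fin j => ℝ) i).prodMap
    (∑ i, LinearMap.proj (R := ℝ) (φ := fun _ : Fin j => ℝ) i))

theorem mem_sumZero {j : ℕ} {x : (Fin j → ℝ) × (Fin j → ℝ)} :
    x ∈ sumZero j ↔ ∑ i, x.1 i = 0 ∧ ∑ i, x.2 i = 0 := by
  simp [sumZero, LinearMap.mem_ker]

theorem finrank_sumZero {j : ℕ} (hj : 1 ≤ j) :
    Module.finrank ℝ (sumZero j) + 2 = 2 * j := by
  have hsurj : Function.Surjective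
      ((∑ i, LinearMap.proj (R := ℝ) (φ := fun _ : Fin j => ℝ) i).prodMap
        (∑ i, LinearMap.proj (R := ℝ) (φ := fun _ : Fin j => ℝ) i)) := by
    rintro ⟨s, t⟩
    exact ⟨(Pi.single ⟨0, hj⟩ s, Pi.single ⟨0, hj⟩ t), by simp⟩
  have h := LinearMap.finrank_range_add_finrank_ker
    ((∑ i, LinearMap.proj (R := ℝ) (φ := fun _ : Fin j => ℝ) i).prodMap
        (∑ i, LinearMap.proj (R := ℝ) (φ := fun _ : Fin j => ℝ) i))
  rw [LinearMap.range_eq_top.2 hsurj, finrank_top] at h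
  simp only [Module.finrank_prod, Module.finrank_self, Module.finrank_fintype_fun_eq_card,
    Fintype.card_fin] at h
  unfold sumZero
  omega

/-- The barycenter of the product of simplices. -/
noncomputable def barycenter (j : ℕ) : (Fin j → ℝ) × (Fin j → ℝ) :=
  (fun _ => 1 / (j : ℝ), fun _ => 1 / (j : ℝ))

/-- The vertex of the product of simplices given by a pair of indices. -/
def vertex {j : ℕ} (a b : Fin j) : (Fin j → ℝ) × (Fin j → ℝ) := (Pi.single a 1, Pi.single b 1)

theorem vertex_sub_barycenter_mem {j : ℕ} (hj : 1 ≤ j) (a b : Fin j) :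
    vertex a b - barycenter j ∈ sumZero j := by
  have : (j : ℝ) ≠ 0 := by positivity
  rw [mem_sumZero]
  simp [vertex, barycenter, this]

/-- The barycenter of the product of simplices is not an interior point of a simplex spanned by
vertices: some nontrivial relation among `2 * j - 1` vertices, taken relative to the barycenter,
has a coefficient that is not positive. -/
theorem not_all_relations_pos {ι : Type*} [Fintype ι] {j : ℕ} (hj : 2 ≤ j)
    (hι : Fintype.card ι + 1 = 2 * j) (a b : ι → Fin j)
    (hrel : ∀ c : ι → ℝ, ∑ i, c i • (vertex (a i) (b i) - barycenter j) = 0 →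
      (∃ i, 0 < c i) → ∀ k, 0 < c k) : False := by
  classical
  have hj0 : (0 : ℝ) < j := by positivity
  have hrank := finrank_sumZero (j := j) (by omega)
  have hrel' : ∀ c : ι → ℝ, ∑ i, c i • (vertex (a i) (b i) - barycenter j) = 0 →
      (∃ i, c i ≠ 0) → ∃ d : ι → ℝ, (∀ k, 0 < d k) ∧ (∀ k, c k = 0 → d k = 0) ∧
        ∑ i, d i • (vertex (a i) (b i) - barycenter j) = 0 := by
    rintro c hc ⟨i, hi⟩
    rcases lt_or_gt_of_ne hi with h | h
    · have hc' : ∑ i, (-c i) • (vertex (a i) (b i) - barycenter j) = 0 := by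
        simp only [neg_smul, Finset.sum_neg_distrib, hc, neg_zero]
      exact ⟨fun i => -c i, hrel _ hc' ⟨i, by linarith⟩, fun k hk => by simp [hk], hc'⟩
    · exact ⟨c, hrel _ hc ⟨i, h⟩, fun k hk => hk, hc⟩
  obtain ⟨c, hcpos, hc⟩ : ∃ c : ι → ℝ, (∀ k, 0 < c k) ∧
      ∑ i, c i • (vertex (a i) (b i) - barycenter j) = 0 := by
    -- There are `2j - 1` vectors in a space of dimension `2j - 2`.
    have hdep : ¬ LinearIndependent ℝ (fun i => (⟨vertex (a i) (b i) - barycenter j,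
        vertex_sub_barycenter_mem (by omega) _ _⟩ : sumZero j)) := by
      intro h
      have := h.fintype_card_le_finrank
      omega
    obtain ⟨c, hc, hne⟩ := Fintype.not_linearIndependent_iff.1 hdep
    have hc' := congrArg Subtype.val hc
    simp only [Submodule.coe_sum, Submodule.coe_smul, Submodule.coe_zero] at hc'
    obtain ⟨d, hd, -, hd'⟩ := hrel' c hc' hne
    exact ⟨d, hd, hd'⟩
  -- Coordinate `r` of the relation: the edges at each node carry total weight `(∑ i, c i) / j`.
  have hrow : ∀ r, ∑ i, (if a i = r then c i else 0) = (∑ i, c i) / j := by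
    intro r
    have h := congrFun (congrArg Prod.fst hc) r
    simp only [vertex, barycenter, Prod.fst_sum, Prod.smul_fst, Prod.fst_sub, Finset.sum_apply,
      Pi.smul_apply, Pi.sub_apply, smul_eq_mul, mul_sub, Finset.sum_sub_distrib, Prod.fst_zero,
      Pi.zero_apply, ← Finset.sum_mul, sub_eq_zero, Pi.single_apply, mul_ite, mul_one,
      mul_zero] at h
    rw [div_eq_mul_one_div, ← h]
    exact Finset.sum_congr rfl fun i _ => by simp only [eq_comm]
  have hcol : ∀ r, ∑ i, (if b i = r then c i else 0) = (∑ i, c i) / j := by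
    intro r
    have h := congrFun (congrArg Prod.snd hc) r
    simp only [vertex, barycenter, Prod.snd_sum, Prod.smul_snd, Prod.snd_sub, Finset.sum_apply,
      Pi.smul_apply, Pi.sub_apply, smul_eq_mul, mul_sub, Finset.sum_sub_distrib, Prod.snd_zero,
      Pi.zero_apply, ← Finset.sum_mul, sub_eq_zero, Pi.single_apply, mul_ite, mul_one,
      mul_zero] at h
    rw [div_eq_mul_one_div, ← h]
    exact Finset.sum_congr rfl fun i _ => by simp only [eq_comm]
  have hΛ : 0 < (∑ i, c i) / j := by
    refine div_pos (Finset.sum_pos (fun i _ => hcpos i) ?_) hj0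
    exact Finset.univ_nonempty_iff.2 (Fintype.card_pos_iff.1 (by omega))
  obtain ⟨r, hr⟩ := Fintype.exists_card_fiber_lt_of_card_lt_mul (f := a) (n := 2)
    (by rw [Fintype.card_fin]; omega)
  obtain ⟨i₀, hi₀⟩ : ∃ i₀, a i₀ = r := by
    by_contra! h
    have := hrow r
    rw [Finset.sum_eq_zero fun i _ => if_neg (h i)] at this
    exact hΛ.ne this
  have huniq : ∀ i, a i = r ↔ i = i₀ := by
    refine fun i => ⟨fun h => ?_, fun h => h ▸ hi₀⟩
    exact Finset.card_le_one.1 (Nat.lt_succ_iff.1 hr) i (by simp [h]) i₀ (by simp [hi₀])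
  have hci₀ : c i₀ = (∑ i, c i) / j := by
    rw [← hrow r]
    simp [huniq]
  -- Edge `i₀` alone exhausts the weight of its other end, leaving nothing for a second edge there.
  have huniq' : ∀ i, b i = b i₀ ↔ i = i₀ := by
    refine fun i => ⟨fun h => ?_, fun h => h ▸ rfl⟩
    by_contra hne
    have h1 := hcol (b i₀)
    rw [← hci₀] at h1
    have h2 : c i₀ + c i ≤ ∑ i, (if b i = b i₀ then c i else 0) := by
      calc c i₀ + c i = ∑ k ∈ {i₀, i}, (if b k = b i₀ then c k else 0) := by
            rw [Finset.sum_pair (Ne.symm hne)]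
            simp [h]
        _ ≤ _ := Finset.sum_le_sum_of_subset_of_nonneg (Finset.subset_univ _)
            fun k _ _ => by split_ifs <;> simp [(hcpos k).le]
    linarith [hcpos i]
  -- As `i₀` is an isolated edge, each vertex has both of these coordinates `1` or both `0`, so `g`
  -- vanishes on all of them and on the barycenter.
  let g : (Fin j → ℝ) × (Fin j → ℝ) →ₗ[ℝ] ℝ :=
    LinearMap.proj (R := ℝ) (φ := fun _ : Fin j => ℝ) r ∘ₗ LinearMap.fst ℝ _ _ -
      LinearMap.proj (R := ℝ) (φ := fun _ : Fin j => ℝ) (b i₀) ∘ₗ LinearMap.snd ℝ _ _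
  have hg : ∀ x, g x = x.1 r - x.2 (b i₀) := fun x => rfl
  have hgu : ∀ i, vertex (a i) (b i) - barycenter j ∈ sumZero j ⊓ LinearMap.ker g := by
    intro i
    refine ⟨vertex_sub_barycenter_mem (by omega) _ _, ?_⟩
    change g _ = 0
    rw [hg]
    have h1 : (r = a i) ↔ i = i₀ := by rw [eq_comm, huniq]
    have h2 : (b i₀ = b i) ↔ i = i₀ := by rw [eq_comm, huniq']
    simp [vertex, barycenter, Pi.single_apply, h1, h2]
  have hlt : Module.finrank ℝ (sumZero j ⊓ LinearMap.ker g : Submodule ℝ _) <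
      Module.finrank ℝ (sumZero j) := by
    refine Submodule.finrank_lt_finrank_of_lt (lt_of_le_of_ne inf_le_left fun h => ?_)
    have : Nontrivial (Fin j) := Fin.nontrivial_iff_two_le.2 hj
    obtain ⟨r', hr'⟩ := exists_ne r
    have hmem : ((Pi.single r 1 - Pi.single r' 1, 0) : (Fin j → ℝ) × (Fin j → ℝ)) ∈ sumZero j := by
      rw [mem_sumZero]
      simp
    rw [← h] at hmem
    have := hmem.2
    change g _ = 0 at this
    rw [hg] at this
    simp [hr'.symm] at this
  -- The extra coordinate forces the coefficient at `i₀` to be zero. The target has dimension at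
  -- most `(2j - 3) + 1`, still less than the number `2j - 1` of vectors.
  have hdep : ¬ LinearIndependent ℝ (fun i => ((⟨vertex (a i) (b i) - barycenter j, hgu i⟩,
      if i = i₀ then 1 else 0) : (sumZero j ⊓ LinearMap.ker g : Submodule ℝ _) × ℝ)) := by
    intro h
    have := h.fintype_card_le_finrank
    rw [Module.finrank_prod, Module.finrank_self] at this
    omega
  obtain ⟨d, hd, hne⟩ := Fintype.not_linearIndependent_iff.1 hdep
  have hd1 := congrArg Subtype.val (congrArg Prod.fst hd)
  have hd2 := congrArg Prod.snd hd
  simp only [Prod.fst_sum, Prod.smul_fst, Submodule.coe_sum, Submodule.coe_smul, Prod.fst_zero,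
    Submodule.coe_zero] at hd1
  simp [Prod.snd_sum] at hd2
  obtain ⟨d', hpos, hzero, -⟩ := hrel' d hd1 hne
  exact (hpos i₀).ne' (hzero i₀ hd2)

end Bipartite

/-! ### The configuration and its interior points -/

section Config

theorem exists_eq_vertex {j : ℕ} {v : (Fin j → ℝ) × (Fin j → ℝ)}
    (hv : v ∈ (prodSimplices j).extremePoints ℝ) : ∃ a b, v = vertex a b := by
  have key : ∀ x ∈ (stdSimplex ℝ (Fin j)).extremePoints ℝ, ∃ a, x = Pi.single a 1 := by
    intro x hx
    rw [← convexHull_basis_eq_stdSimplex] at hx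
    obtain ⟨a, rfl⟩ := extremePoints_convexHull_subset hx
    exact ⟨a, by ext i; simp [Pi.single_apply, eq_comm]⟩
  rw [prodSimplices, extremePoints_prod] at hv
  obtain ⟨a, ha⟩ := key _ hv.1
  obtain ⟨b, hb⟩ := key _ hv.2
  exact ⟨a, b, Prod.ext ha hb⟩

theorem exists_eq_vertex_of_mem_config {j : ℕ} {v : (Fin j → ℝ) × (Fin j → ℝ)}
    (hv : v ∈ prodSimplicesConfig j) (hne : v ≠ barycenter j) : ∃ a b, v = vertex a b :=
  exists_eq_vertex (hv.resolve_left hne)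

theorem finite_config (j : ℕ) : (prodSimplicesConfig j).Finite := by
  refine Set.Finite.insert _ ((Set.finite_range fun p : Fin j × Fin j => vertex p.1 p.2).subset ?_)
  intro v hv
  obtain ⟨a, b, rfl⟩ := exists_eq_vertex hv
  exact ⟨(a, b), rfl⟩

theorem barycenter_mem_prodSimplices {j : ℕ} (hj : 1 ≤ j) : barycenter j ∈ prodSimplices j := by
  have h : (fun _ => 1 / (j : ℝ) : Fin j → ℝ) ∈ stdSimplex ℝ (Fin j) := by
    have : (j : ℝ) ≠ 0 := by positivity
    exact ⟨fun _ => by positivity, by simp [this]⟩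
  exact ⟨h, h⟩

theorem convexHull_config_subset {j : ℕ} (hj : 1 ≤ j) :
    convexHull ℝ (prodSimplicesConfig j) ⊆ prodSimplices j :=
  convexHull_min (Set.insert_subset (barycenter_mem_prodSimplices hj) extremePoints_subset)
    ((convex_stdSimplex ℝ _).prod (convex_stdSimplex ℝ _))

/-- An upper bound on the dimension suffices: the codimension equation of a split forces equality.
-/
theorem vectorSpan_config_le {j : ℕ} (hj : 1 ≤ j) :
    vectorSpan ℝ (prodSimplicesConfig j) ≤ sumZero j := by
  rw [vectorSpan_def, Submodule.span_le]
  rintro _ ⟨x, hx, y, hy, rfl⟩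
  have hx' := convexHull_config_subset hj (subset_convexHull ℝ _ hx)
  have hy' := convexHull_config_subset hj (subset_convexHull ℝ _ hy)
  change x - y ∈ sumZero j
  rw [mem_sumZero]
  simp [hx'.1.2, hx'.2.2, hy'.1.2, hy'.2.2]

theorem vectorSpan_convexHull_eq {E : Type*} [AddCommGroup E] [Module ℝ E] (s : Set E) :
    vectorSpan ℝ (convexHull ℝ s) = vectorSpan ℝ s := by
  rw [← direction_affineSpan, affineSpan_convexHull, direction_affineSpan]

/-- The only relative interior point of the configuration is its barycenter. -/
theorem eq_barycenter_of_mem_relint {j : ℕ} (hj : 1 ≤ j) {h : (Fin j → ℝ) × (Fin j → ℝ)}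
    (hP : h ∈ prodSimplicesConfig j) (hint : h ∈ relint (prodSimplicesConfig j)) :
    h = barycenter j := by
  by_contra hne
  have hext := hP.resolve_left hne
  have hq : barycenter j ∈ prodSimplicesConfig j := Set.mem_insert _ _
  have hu : h - barycenter j ∈ vectorSpan ℝ (convexHull ℝ (prodSimplicesConfig j)) := by
    rw [vectorSpan_convexHull_eq]
    exact vsub_mem_vectorSpan ℝ hP hq
  obtain ⟨ε, hε, hmem⟩ := exists_add_smul_mem_of_mem_intrinsicInterior hint hu
  -- An interior point could be passed slightly when coming from the barycenter, so it would not be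
  -- extreme.
  have hseg : h ∈ openSegment ℝ (barycenter j) (h + ε • (h - barycenter j)) := by
    refine ⟨ε / (1 + ε), 1 / (1 + ε), by positivity, by positivity, by field_simp; ring, ?_⟩
    have h1 : (1 + ε) ≠ 0 := by positivity
    have h2 : (1 / (1 + ε)) * ε = ε / (1 + ε) := by ring
    have h3 : h = (1 / (1 + ε) + ε / (1 + ε)) • h := by
      rw [← add_div, div_self h1, one_smul]
    rw [smul_add, smul_smul, h2]
    nth_rewrite 3 [h3]
    module
  exact hne (hext.2 (barycenter_mem_prodSimplices hj) (convexHull_config_subset hj hmem) hseg).symm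

theorem config_one : prodSimplicesConfig 1 ⊆ {barycenter 1} := by
  intro v hv
  by_contra hne
  obtain ⟨a, b, rfl⟩ := exists_eq_vertex_of_mem_config hv hne
  obtain rfl := Subsingleton.elim a b
  refine hne ?_
  rw [Set.mem_singleton_iff, vertex, barycenter]
  ext i <;> simp [Subsingleton.elim i a]

end Config

/-! ### The fan of cells around an interior vertex -/

section Fan

variable {E : Type*} [NormedAddCommGroup E] [NormedSpace ℝ E] [FiniteDimensional ℝ E]

/-- Let a subdivision of a `d`-dimensional configuration have `d + 1 ≥ 3` maximal cells with a
common vertex `q` interior to the configuration. Then there are points `v C`, one for each maximal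
cell, such that the coefficients of any nontrivial relation among the `v C - q` have the same strict
sign. -/
theorem IsSubdivision.exists_simplex {P : Set E} {S : Set (Set E)} (hP : P.Finite)
    (hS : IsSubdivision P S) [Fintype (maximalCells S)]
    (hcard : Fintype.card (maximalCells S) = Module.finrank ℝ (vectorSpan ℝ P) + 1)
    (hdim : 0 < Module.finrank ℝ (vectorSpan ℝ P)) {q : E} (hq : q ∈ relint P)
    (hface : ∀ C ∈ maximalCells S, IsFace {q} C) :
    ∃ v : maximalCells S → E, (∀ C, v C ∈ P) ∧ (∀ C, v C ≠ q) ∧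
      ∀ c : maximalCells S → ℝ, ∑ C, c C • (v C - q) = 0 → (∃ C, 0 < c C) → ∀ C, 0 < c C := by
  classical
  have hcell : ∀ C : maximalCells S, (C : Set E) ∈ S := fun C => C.2.prop
  have hsub : ∀ C : maximalCells S, (C : Set E) ⊆ P := fun C => hS.subset C (hcell C)
  choose l hl using fun C : maximalCells S => (hface C C.2).2
  have hqC : ∀ C : maximalCells S, q ∈ (C : Set E) := fun C =>
    ((hl C).subset (Set.mem_singleton q)).1
  have hneg : ∀ (C : maximalCells S), ∀ v ∈ (C : Set E), v ≠ q → l C (v - q) < 0 := by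
    intro C v hv hvq
    have h1 := ((hl C).subset (Set.mem_singleton q)).2
    have h2 : l C v ≠ l C q := fun h =>
      hvq ((hl C).symm.subset ⟨hv, fun y hy => h ▸ h1 y hy⟩)
    rw [map_sub]
    exact sub_neg.2 (lt_of_le_of_ne (h1 v hv) h2)
  -- The nonzero edge vectors from `q` generate the cone of the cell; the functional exposing `q` is
  -- strictly negative on them.
  let G : maximalCells S → Finset E := fun C =>
    ((hP.subset (hsub C)).toFinset.erase q).image (· - q)
  have hG : ∀ (C : maximalCells S) (g : E), g ∈ G C ↔ g ≠ 0 ∧ q + g ∈ (C : Set E) := by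
    intro C g
    simp only [G, Finset.mem_image, Finset.mem_erase, Set.Finite.mem_toFinset]
    constructor
    · rintro ⟨v, ⟨hvq, hv⟩, rfl⟩
      exact ⟨sub_ne_zero.2 hvq, by simpa using hv⟩
    · rintro ⟨hg, hv⟩
      exact ⟨q + g, ⟨by simpa using hg, hv⟩, by simp⟩
  have hlG : ∀ C, ∀ g ∈ G C, l C g < 0 := by
    intro C g hg
    obtain ⟨hg0, hv⟩ := (hG C g).1 hg
    simpa using hneg C _ hv (by simpa using hg0)
  let K : maximalCells S → PointedCone ℝ E := fun C => PointedCone.hull ℝ (G C : Set E)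
  have hKcl : ∀ C, IsClosed (K C : Set E) := fun C => isClosed_hull (G C) (l C) (hlG C)
  have hKl : ∀ C, ∀ x ∈ K C, x ≠ 0 → l C x < 0 := fun C => hull_pointed (l C) (hlG C)
  have hcov : ∀ x ∈ vectorSpan ℝ P, ∃ C, x ∈ K C := by
    intro x hx
    rw [← vectorSpan_convexHull_eq] at hx
    obtain ⟨ε, hε, hmem⟩ := exists_add_smul_mem_of_mem_intrinsicInterior hq hx
    rw [← hS.union] at hmem
    simp only [Set.mem_iUnion] at hmem
    obtain ⟨C, hC, hxC⟩ := hmem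
    have hfin : S.Finite := hP.finite_subsets.subset hS.subset
    obtain ⟨D, hCD, hD⟩ := hfin.exists_le_maximal hC
    refine ⟨⟨D, hD⟩, mem_hull_of_add_smul_mem (C := D) (q := q) _ (fun v hv hvq => ?_) hε
      (convexHull_mono hCD hxC)⟩
    exact (hG ⟨D, hD⟩ _).2 ⟨sub_ne_zero.2 hvq, by simpa using hv⟩
  have hexists : ∀ m : maximalCells S, ∃ v ≠ q, ∀ C : maximalCells S, C ≠ m → v ∈ (C : Set E) := by
    intro m
    have hs : (Finset.univ.erase m).card = Module.finrank ℝ (vectorSpan ℝ P) := by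
      rw [Finset.card_erase_of_mem (Finset.mem_univ m), Finset.card_univ, hcard]; rfl
    have hsne : (Finset.univ.erase m).Nonempty := Finset.card_pos.1 (by omega)
    obtain ⟨u, -, hu0, hu⟩ := exists_common_ray K l hKcl hKl m (Finset.univ.erase m) hsne
      (vectorSpan ℝ P) hs.symm (by
        intro x hx
        obtain ⟨C, hC⟩ := hcov x hx
        by_cases h : C = m
        · exact Or.inl (h ▸ hC)
        · exact Or.inr ⟨C, by simp [h], hC⟩)
    -- A common ray becomes a common point: finitely many cells allow one step length for all.
    have hev : ∀ᶠ ε : ℝ in nhdsWithin 0 (Set.Ioi 0), ∀ C : maximalCells S, C ≠ m →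
        q + ε • u ∈ convexHull ℝ (C : Set E) := by
      rw [Filter.eventually_all]
      intro C
      by_cases h : C = m
      · simp [h]
      obtain ⟨δ, hδ, hmem⟩ := exists_forall_add_smul_mem (hqC C) (G C)
        (fun g hg => ((hG C g).1 hg).2) (hu C (by simp [h]))
      filter_upwards [Ioc_mem_nhdsGT hδ] with ε hε _
      exact hmem ε hε.1 hε.2
    obtain ⟨ε, hε, hε0⟩ := (hev.and self_mem_nhdsWithin).exists
    obtain ⟨C₀, hC₀⟩ := hsne
    obtain ⟨v, hvq, hv⟩ := hS.exists_common_point hP (M := {C | ∃ D : maximalCells S, D ≠ m ∧ D = C})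
      (x := q + ε • u) (q := q) (by rintro _ ⟨D, -, rfl⟩; exact hcell D)
      ⟨C₀, C₀, Finset.ne_of_mem_erase hC₀, rfl⟩ (by rintro _ ⟨D, hD, rfl⟩; exact hε D hD)
      (by simpa using ⟨(ne_of_gt hε0), hu0⟩)
    exact ⟨v, hvq, fun C hC => hv C ⟨C, hC, rfl⟩⟩
  choose v hvq hv using hexists
  have hvP : ∀ C, v C ∈ P := by
    intro C
    obtain ⟨D, hD⟩ := Fintype.exists_ne_of_one_lt_card (by omega) C
    exact hsub D (hv C D hD)
  have hqP : q ∈ P := by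
    obtain ⟨C⟩ : Nonempty (maximalCells S) := Fintype.card_pos_iff.1 (by omega)
    exact hsub C (hqC C)
  refine ⟨v, hvP, hvq, fun c hc ⟨C, hC⟩ => ?_⟩
  exact coeff_pos_of_relation (vectorSpan ℝ P) (fun C => v C - q) l
    (fun C => vsub_mem_vectorSpan ℝ (hvP C) hqP)
    (fun C D h => hneg C _ (hv D C h) (hvq D))
    (fun x hx hx0 => (hcov x hx).imp fun C hC => hKl C x hC hx0) c hc hC

end Fan

/-! ### One-point configurations and the conclusion -/

theorem mem_subdivision_of_subsingleton {E : Type*} [AddCommGroup E] [Module ℝ E]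
    [TopologicalSpace E] {P : Set E} {S : Set (Set E)} (hS : IsSubdivision P S)
    (hP : P.Subsingleton) (hne : P.Nonempty) : P ∈ S := by
  obtain ⟨x, hx⟩ := hne
  have h := subset_convexHull ℝ P hx
  rw [← hS.union] at h
  simp only [Set.mem_iUnion] at h
  obtain ⟨C, hC, -⟩ := h
  have : C = P := (hP.eq_singleton_of_mem hx ▸
    (Set.Nonempty.subset_singleton_iff (hS.nonempty C hC)).1
      (hP.eq_singleton_of_mem hx ▸ hS.subset C hC))
  exact this ▸ hC

end PointConfig

open PointConfig in
theorem mainTheorem7 (j : ℕ) (hj : 1 ≤ j) :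
    ¬ ∃ S : Set (Set ((Fin j → ℝ) × (Fin j → ℝ))),
      PointConfig.IsKSplit (2 * j - 1) (PointConfig.prodSimplicesConfig j) S := by
  rintro ⟨S, ⟨hS, htriv, -⟩, hcard, H, hH, hface, hdim, hint⟩
  rcases hj.eq_or_lt with rfl | hj2
  · exact htriv (mem_subdivision_of_subsingleton hS
      (Set.subsingleton_singleton.anti config_one) ⟨_, Set.mem_insert _ _⟩)
  have hrank := finrank_sumZero hj
  have hle := Submodule.finrank_mono (vectorSpan_config_le hj)
  unfold dim at hdim
  -- From `dim H + (2j - 1) = dim P + 1` and `dim P ≤ 2j - 2`.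
  have hH0 : Module.finrank ℝ (vectorSpan ℝ H) = 0 := by omega
  have hPdim : Module.finrank ℝ (vectorSpan ℝ (prodSimplicesConfig j)) + 2 = 2 * j := by omega
  have hHs : H.Subsingleton :=
    (vectorSpan_eq_bot_iff_subsingleton ℝ).1 (Submodule.finrank_eq_zero.1 hH0)
  obtain ⟨h, hh⟩ := hS.nonempty H hH
  obtain rfl := hHs.eq_singleton_of_mem hh
  have hrel : h ∈ relint (prodSimplicesConfig j) := hint (by simp [relint])
  obtain rfl := eq_barycenter_of_mem_relint hj (hS.subset _ hH rfl) hrel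
  have hfin : (maximalCells S).Finite := Set.finite_of_encard_eq_coe hcard
  have : Fintype (maximalCells S) := hfin.fintype
  have hcard' : Fintype.card (maximalCells S) = 2 * j - 1 := by
    have h1 := Set.encard_coe_eq_coe_finsetCard (maximalCells S).toFinset
    rw [Set.coe_toFinset, hcard, Set.toFinset_card] at h1
    exact_mod_cast h1.symm
  obtain ⟨v, hvP, hvq, hv⟩ := hS.exists_simplex (finite_config j) (by omega) (by omega) hrel hface
  choose a b hab using fun C => exists_eq_vertex_of_mem_config (hvP C) (hvq C)
  refine not_all_relations_pos hj2 (by omega) a b fun c hc => hv c ?_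
  simpa only [hab] using hc
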